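/- **Setting.** Let $f:\mathbb R^{m_1}\times\dots\times\mathbb R^{m_n}\to\mathbb R$ be differentiable and, for $i=1,\dots,n$, let $h_i:\mathbb R^{m_i}\to\mathbb R^{p_i}$ be differentiable with convex components. Put $S_i=\{w\in\mathbb R^{m_i}: h_i(w)\le 0\}$ and $F(z)=f(z)+\sum_{i=1}^n\delta_{S_i}(x_i)$ for $z=(x_1,\dots,x_n)$, where $\delta_{S_i}$ is $0$ on $S_i$ and $\infty$ elsewhere. A point $z$ is a stationary point of $F$ if $0\in\partial F(z)$, i.e. $F(z)<\infty$ and $\liminf_{y\to z,\,y\ne z}\frac{F(y)-F(z)}{\|y-z\|}\ge 0$ (Fréchet subdifferential). Fix $\bar\varepsilon>0$ and let $\bar S_i=\{w:\operatorname{dist}(w,S_i)\le\bar\varepsilon\}$. **Assumptions.** 1. (Lipschitz gradients) There are $L_i>0$ with $\|\nabla_i f(z_1)-\nabla_i f(z_2)\|\le L_i\|z_1-z_2\|$ for all $z_1,z_2\in\bar S_1\times\dots\times\bar S_n$, $i=1,\dots,n$. Let $L=\max_i L_i$, $\gamma>1$, $M_l=\gamma L$ and $M_u\ge M_l$. 2.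 (Compactness) Each $S_i$ is convex and compact; each $h_i$ is linear (i.e. $h_i(w)=A_iw+b_i$) or satisfies Slater's condition ($h_i(\hat x_i)<0$ componentwise for some $\hat x_i$); and there are $\tilde c_i\ge0$ such that $\operatorname{dist}(x_i,S_i)\le\tilde c_i\|\max\{h_i(x_i),0\}\|$ for all $x_i$ with $\operatorname{dist}(x_i,\bar S_i)\le\bar{\mathcal M}_i/M_l$, where $\bar{\mathcal M}_i=\sup_{z\in\bar S_1\times\dots\times\bar S_n}\|\nabla_i f(z)\|$. **Algorithm.** Let $0\le\varepsilon^{(k)}\le\bar\varepsilon$ and $\sigma_i^{(k)}\in[M_l,M_u]$ for all $k\ge0$ and all $i$. Starting from an arbitrary $z^{(0)}=(x_1^{(0)},\dots,x_n^{(0)})$, the iterates $z^{(k)}=(x_1^{(k)},\dots,x_n^{(k)})$ are generated as follows: for $k\ge0$ and $i=1,\dots,n$ put $g_i^{(k)}=\nabla_i f(x_1^{(k+1)},\dots,x_{i-1}^{(k+1)},x_i^{(k)},\dots,x_n^{(k)})$ and $\tilde x_i^{(k)}=x_i^{(k)}-g_i^{(k)}/\sigma_i^{(k)}$; then $x_i^{(k+1)}\in\mathbb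 R^{m_i}$ is any point for which some $\lambda_i^{(k+1)}\in\mathbb R^{p_i}_{+}$ satisfies $\sqrt{r_i(x_i^{(k+1)},\lambda_i^{(k+1)},\tilde x_i^{(k)})}\le\varepsilon^{(k)}$, where $$r_i(x,\lambda,\tilde x)=\max\{\langle x,\,x-\tilde x+\nabla h_i(x)\lambda\rangle,0\}+\|x-\tilde x+\nabla h_i(x)\lambda\|_\infty+\|\max\{h_i(x),0\}\|_\infty+\max\{-\langle\lambda,h_i(x)\rangle,0\}$$ and $\nabla h_i(x)\lambda=\sum_j\lambda_j\nabla h_{i,j}(x)$. For $k\ge0$ let $\bar z^{(k+1)}=(\bar x_1^{(k+1)},\dots,\bar x_n^{(k+1)})$ be given by the exact subproblem solutions $$\bar x_i^{(k+1)}=\operatorname*{arg\,min}_{x_i\in S_i}\ \langle g_i^{(k)},x_i-x_i^{(k)}\rangle+\tfrac{\sigma_i^{(k)}}2\|x_i-x_i^{(k)}\|^2 .$$ Let $\Omega(z^{(0)})$ be the set of accumulation points (limits of subsequences) of $\{z^{(k)}\}$. **Proposition.** Under Assumptions 1 and 2, if $\sum_{k}(\varepsilon^{(k)})^2<\infty$,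 then: (i) $\Omega(z^{(0)})$ is nonempty, is contained in $S_1\times\dots\times S_n$, and each of its elements is a stationary point of $F$; (ii) $\Omega(z^{(0)})$ is compact and connected, and $\operatorname{dist}(\bar z^{(k)},\Omega(z^{(0)}))\to0$ as $k\to\infty$; (iii) $F$ is finite and constant on $\Omega(z^{(0)})$. -/

import Mathlib

open Set Filter Topology

noncomputable section

namespace PALMI

/-- The product of the Euclidean spaces `ℝ^{m_1}, …, ℝ^{m_n}`, with its Euclidean structure. -/
abbrev BlockSpace {n : ℕ} (m : Fin n → ℕ) : Type :=
  PiLp 2 (fun i => EuclideanSpace ℝ (Fin (m i)))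

/-- The partial gradient `∇_i f(z)`, i.e. the `i`-th block of the gradient of `f` at `z`. -/
def blockGradient {n : ℕ} {m : Fin n → ℕ} (f : BlockSpace m → ℝ) (i : Fin n)
    (z : BlockSpace m) : EuclideanSpace ℝ (Fin (m i)) :=
  (gradient f z) i

/-- The feasible set `{w : h(w) ≤ 0}` (componentwise inequality). -/
def feasibleSet {m p : ℕ} (h : EuclideanSpace ℝ (Fin m) → EuclideanSpace ℝ (Fin p)) :
    Set (EuclideanSpace ℝ (Fin m)) :=
  {w | ∀ j, h w j ≤ 0}

/-- The Cartesian product of sets, one in each block. -/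
def blockProduct {n : ℕ} {m : Fin n → ℕ} (S : ∀ i, Set (EuclideanSpace ℝ (Fin (m i)))) :
    Set (BlockSpace m) :=
  {z | ∀ i, z i ∈ S i}

/-- The indicator function of a set: `0` on the set and `∞` outside. -/
def indicatorFun {E : Type*} (S : Set E) (w : E) : EReal :=
  haveI := Classical.propDecidable (w ∈ S)
  if w ∈ S then 0 else ⊤

/-- The extended-valued objective `F(z) = f(z) + ∑ i, δ_{S_i}(x_i)`. -/
def extendedObjective {n : ℕ} {m : Fin n → ℕ} (f : BlockSpace m → ℝ)
    (S : ∀ i, Set (EuclideanSpace ℝ (Fin (m i)))) (z : BlockSpace m) : EReal :=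
  (f z : EReal) + ∑ i, indicatorFun (S i) (z i)

/-- The Fréchet subdifferential of an extended-valued function (empty off the effective domain). -/
def frechetSubdifferential {E : Type*} [NormedAddCommGroup E] [InnerProductSpace ℝ E]
    (G : E → EReal) (x : E) : Set E :=
  {u | G x < ⊤ ∧
    0 ≤ liminf (fun y => (G y - G x - ((inner ℝ u (y - x) : ℝ) : EReal)) / ((‖y - x‖ : ℝ) : EReal))
      (𝓝[≠] x)}

/-- `x` is a stationary point of `G` if `0 ∈ ∂G(x)`. -/
def IsStationary {E : Type*} [NormedAddCommGroup E] [InnerProductSpace ℝ E]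
    (G : E → EReal) (x : E) : Prop :=
  0 ∈ frechetSubdifferential G x

/-- The componentwise positive part `max{v, 0}` of a vector. -/
def posPart {p : ℕ} (v : EuclideanSpace ℝ (Fin p)) : EuclideanSpace ℝ (Fin p) :=
  WithLp.toLp 2 (fun j => max (v j) 0)

/-- The `ℓ^∞` norm of a vector (the function type `Fin p → ℝ` carries the sup norm). -/
def normInf {p : ℕ} (v : EuclideanSpace ℝ (Fin p)) : ℝ :=
  ‖(WithLp.ofLp v : Fin p → ℝ)‖

/-- The product `∇h(x) λ = ∑ j, λ_j ∇h_j(x)`. -/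
def jacobianMul {m p : ℕ} (h : EuclideanSpace ℝ (Fin m) → EuclideanSpace ℝ (Fin p))
    (x : EuclideanSpace ℝ (Fin m)) (lam : EuclideanSpace ℝ (Fin p)) :
    EuclideanSpace ℝ (Fin m) :=
  ∑ j, lam j • gradient (fun w => h w j) x

/-- The residual function `r(x, λ, x̃)` of the projection of `x̃` onto `{w : h(w) ≤ 0}`. -/
def residual {m p : ℕ} (h : EuclideanSpace ℝ (Fin m) → EuclideanSpace ℝ (Fin p))
    (x : EuclideanSpace ℝ (Fin m)) (lam : EuclideanSpace ℝ (Fin p))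
    (xt : EuclideanSpace ℝ (Fin m)) : ℝ :=
  max (inner ℝ x (x - xt + jacobianMul h x lam)) 0
    + normInf (x - xt + jacobianMul h x lam)
    + normInf (posPart (h x))
    + max (-(inner ℝ lam (h x))) 0

/-- The point `(x_{<i}, y_{≥i})`: blocks before `i` from `x`, the others from `y`. -/
def mixed {n : ℕ} {m : Fin n → ℕ} (i : Fin n) (x y : BlockSpace m) : BlockSpace m :=
  WithLp.toLp 2 (fun j => if j < i then x j else y j)

/-- The objective of the `i`-th proximal linearized subproblem,
`⟨∇_i f(x_{<i}^+, x_{≥i}), w - x_i⟩ + (σ/2) ‖w - x_i‖²`, where `z` is the current iterate and the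
blocks before `i` of `znext` are already computed. -/
def subproblemObjective {n : ℕ} {m : Fin n → ℕ} (f : BlockSpace m → ℝ) (sigma : ℝ) (i : Fin n)
    (znext z : BlockSpace m) (w : EuclideanSpace ℝ (Fin (m i))) : ℝ :=
  inner ℝ (blockGradient f i (mixed i znext z)) (w - z i) + sigma / 2 * ‖w - z i‖ ^ 2

/-- The point `x̃_i = x_i - (1/σ) ∇_i f(x_{<i}^+, x_{≥i})` whose projection solves the
subproblem. -/
def gradientStep {n : ℕ} {m : Fin n → ℕ} (f : BlockSpace m → ℝ) (sigma : ℝ) (i : Fin n)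
    (znext z : BlockSpace m) : EuclideanSpace ℝ (Fin (m i)) :=
  z i - (1 / sigma) • blockGradient f i (mixed i znext z)

/-- `z` is an iterate sequence (with proximal parameters `sigma`) generated by the infeasible
inexact proximal alternating linearized minimization method, run with tolerances
`eps k ∈ [0, epsBar]` and bounds `0 < Ml ≤ Mu` on the proximal parameters. -/
structure IsIterateSequence {n : ℕ} {m p : Fin n → ℕ} (f : BlockSpace m → ℝ)
    (h : ∀ i, EuclideanSpace ℝ (Fin (m i)) → EuclideanSpace ℝ (Fin (p i)))
    (epsBar : ℝ) (eps : ℕ → ℝ) (Ml Mu : ℝ) (sigma : ℕ → Fin n → ℝ)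
    (z : ℕ → BlockSpace m) : Prop where
  epsBar_pos : 0 < epsBar
  eps_nonneg : ∀ k, 0 ≤ eps k
  eps_le : ∀ k, eps k ≤ epsBar
  Ml_pos : 0 < Ml
  Ml_le_Mu : Ml ≤ Mu
  sigma_mem : ∀ k i, sigma k i ∈ Icc Ml Mu
  step : ∀ k i, ∃ lam : EuclideanSpace ℝ (Fin (p i)), (∀ j, 0 ≤ lam j) ∧
    √(residual (h i) (z (k + 1) i) lam (gradientStep f (sigma k i) i (z (k + 1)) (z k))) ≤ eps k

/-- `zbar (k + 1)` collects, for all blocks `i`, the exact minimizers over `S_i` of the subproblems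
met in iteration `k`. Nothing is required of `zbar 0`, which is not produced by the method. -/
def IsExactSequence {n : ℕ} {m : Fin n → ℕ} (f : BlockSpace m → ℝ)
    (S : ∀ i, Set (EuclideanSpace ℝ (Fin (m i)))) (sigma : ℕ → Fin n → ℝ)
    (z zbar : ℕ → BlockSpace m) : Prop :=
  ∀ k i, zbar (k + 1) i ∈ S i ∧
    IsMinOn (subproblemObjective f (sigma k i) i (z (k + 1)) (z k)) (S i) (zbar (k + 1) i)

/-- On the product of the sets `T_i`, each partial gradient `∇_i f` is Lipschitz with modulus
`Lip i > 0`. -/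
def BlockLipschitzGradient {n : ℕ} {m : Fin n → ℕ} (f : BlockSpace m → ℝ)
    (T : ∀ i, Set (EuclideanSpace ℝ (Fin (m i)))) (Lip : Fin n → ℝ) : Prop :=
  ∀ i, 0 < Lip i ∧ ∀ z₁ ∈ blockProduct T, ∀ z₂ ∈ blockProduct T,
    ‖blockGradient f i z₁ - blockGradient f i z₂‖ ≤ Lip i * ‖z₁ - z₂‖

/-- `h` is linear in the sense of linear constraints, `h(x) = A x + b`. -/
def IsLinearConstraint {m p : ℕ}
    (h : EuclideanSpace ℝ (Fin m) → EuclideanSpace ℝ (Fin p)) : Prop :=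
  ∃ (A : EuclideanSpace ℝ (Fin m) →ₗ[ℝ] EuclideanSpace ℝ (Fin p)) (b : EuclideanSpace ℝ (Fin p)),
    ∀ x, h x = A x + b

/-- The Slater constraint qualification. -/
def Slater {m p : ℕ} (h : EuclideanSpace ℝ (Fin m) → EuclideanSpace ℝ (Fin p)) : Prop :=
  ∃ x, ∀ j, h x j < 0

/-- The supremum of `‖∇_i f‖` over the product of the sets `T_i`. -/
def gradientBound {n : ℕ} {m : Fin n → ℕ} (f : BlockSpace m → ℝ)
    (T : ∀ i, Set (EuclideanSpace ℝ (Fin (m i)))) (i : Fin n) : ℝ :=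
  sSup ((fun z => ‖blockGradient f i z‖) '' blockProduct T)

/-- The Hoffman-like error bound on a set `T`:
`dist(x, {h ≤ 0}) ≤ c ‖max{h(x), 0}‖` for all `x ∈ T`, with some constant `c ≥ 0`. -/
def HoffmanBoundOn {m p : ℕ} (h : EuclideanSpace ℝ (Fin m) → EuclideanSpace ℝ (Fin p))
    (T : Set (EuclideanSpace ℝ (Fin m))) : Prop :=
  ∃ c : ℝ, 0 ≤ c ∧ ∀ x ∈ T, Metric.infDist x (feasibleSet h) ≤ c * ‖posPart (h x)‖

/-- The set of accumulation points (subsequential limits) of a sequence. -/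
def accumulationPoints {E : Type*} [TopologicalSpace E] (z : ℕ → E) : Set E :=
  {a | ∃ φ : ℕ → ℕ, StrictMono φ ∧ Tendsto (z ∘ φ) atTop (𝓝 a)}

end PALMI

end

/-! After finitely many iterations the method is an alternating projected gradient method with
summable errors. Convexity of the constraints turns a residual of at most `eps k ^ 2` into the
variational inequality of the projection, up to a multiple of `eps k ^ 2`
(`inner_le_of_residual_le`). Since the level sets of each `h i` shrink to its compact feasible set
(`exists_level_infDist_le`), late iterates lie where the gradients are Lipschitz and the error bound
holds, so their infeasibility is also of order `eps k ^ 2`. A tail of the sequence is thus an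
`IsApproximateRun`.

For such a run, `f` decreases by `(Ml - L)` times the squared increment, up to a summable error
(`descent`). As `L < Ml`, the values converge and the increments vanish. Limits of subsequences are
then feasible and satisfy the blockwise variational inequality, hence are stationary; `f` equals the
limit value at each of them. Vanishing increments in a compact set give connectedness, and comparing
exact and inexact projections of one point gives `zbar k - z k → 0`. -/

namespace PALMI

/-! ### Convex functions and their level sets. -/

/-- The first-order characterization of convexity, in terms of the gradient. -/
theorem ConvexOn.add_inner_gradient_le {E : Type*} [NormedAddCommGroup E] [InnerProductSpace ℝ E]
    [CompleteSpace E] {g : E → ℝ} (hg : ConvexOn ℝ univ g) {x : E} (hd : DifferentiableAt ℝ g x)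
    (y : E) : g x + inner ℝ (gradient g x) (y - x) ≤ g y := by
  have hline : ConvexOn ℝ univ (fun t : ℝ => g (AffineMap.lineMap x y t)) := by
    exact hg.comp_affineMap (AffineMap.lineMap x y : ℝ →ᵃ[ℝ] E)
  have hder : HasDerivAt (fun t : ℝ => g (AffineMap.lineMap x y t))
      (inner ℝ (gradient g x) (y - x)) 0 := by
    rw [inner_gradient_left]
    have h1 : HasDerivAt (fun t : ℝ => AffineMap.lineMap x y t) (y - x) (0 : ℝ) :=
      AffineMap.hasDerivAt_lineMap
    have h2 : HasFDerivAt g (fderiv ℝ g x) (AffineMap.lineMap x y (0 : ℝ)) := by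
      simpa using hd.hasFDerivAt
    exact h2.comp_hasDerivAt (0 : ℝ) h1
  have := hline.le_slope_of_hasDerivAt (mem_univ 0) (mem_univ 1) one_pos hder
  simp only [slope_def_field, AffineMap.lineMap_apply_zero, AffineMap.lineMap_apply_one] at this
  linarith

/-- The level sets of a convex mapping with compact feasible set shrink to the feasible set. -/
theorem exists_level_infDist_le {m p : ℕ}
    {h : EuclideanSpace ℝ (Fin m) → EuclideanSpace ℝ (Fin p)} (hc : Continuous h)
    (hconv : ∀ j, ConvexOn ℝ univ fun w => h w j) (hcomp : IsCompact (feasibleSet h))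
    (hne : (feasibleSet h).Nonempty) {η : ℝ} (hη : 0 < η) :
    ∃ δ > 0, ∀ x, (∀ j, h x j ≤ δ) → Metric.infDist x (feasibleSet h) ≤ η := by
  set S := feasibleSet h with hS
  set B : Set (EuclideanSpace ℝ (Fin m)) := {x | Metric.infDist x S = η} with hB
  have hBcomp : IsCompact B := by
    refine hcomp.cthickening (r := η) |>.of_isClosed_subset
      (isClosed_eq (Metric.continuous_infDist_pt S) continuous_const) fun x hx => ?_
    obtain ⟨q, hq, hqd⟩ := hcomp.exists_infDist_eq_dist hne x
    exact Metric.mem_cthickening_of_dist_le x q η S hq (by rw [← hqd]; exact le_of_eq hx)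
  have hφc : Continuous fun x => ∑ j, max (h x j) 0 := by fun_prop
  obtain ⟨δ₀, hδ₀, hmin⟩ : ∃ δ₀ > 0, ∀ x ∈ B, δ₀ ≤ ∑ j, max (h x j) 0 := by
    rcases B.eq_empty_or_nonempty with hBe | hBne
    · exact ⟨1, one_pos, fun x hx => by simp [hBe] at hx⟩
    obtain ⟨x₀, hx₀, hmin⟩ := hBcomp.exists_isMinOn hBne hφc.continuousOn
    refine ⟨∑ j, max (h x₀ j) 0, ?_, fun x hx => hmin hx⟩
    have hx₀S : x₀ ∉ S := fun hmem => by
      have : Metric.infDist x₀ S = η := hx₀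
      rw [Metric.infDist_zero_of_mem hmem] at this
      exact hη.ne this
    obtain ⟨j, hj⟩ : ∃ j, 0 < h x₀ j := by
      by_contra! hcon
      exact hx₀S hcon
    exact Finset.sum_pos' (fun _ _ => le_max_right _ _) ⟨j, Finset.mem_univ _, lt_max_of_lt_left hj⟩
  -- With `p + 1` in the denominator, `p` components of size at most this level sum to strictly less
  -- than `δ₀`, also when `p = 0`.
  refine ⟨δ₀ / (p + 1), by positivity, fun x hx => ?_⟩
  by_contra! hlt
  obtain ⟨q, hq, -⟩ := hcomp.exists_infDist_eq_dist hne x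
  -- The segment from a feasible point to a too distant `x` crosses `B`; by convexity the
  -- constraints are still small at the crossing, contradicting the minimum over `B`.
  have hcont : ContinuousOn (fun t : ℝ => Metric.infDist (AffineMap.lineMap q x t) S) (Icc 0 1) :=
    ((Metric.continuous_infDist_pt S).comp AffineMap.lineMap_continuous).continuousOn
  obtain ⟨t, ⟨ht0, ht1⟩, ht⟩ := intermediate_value_Icc zero_le_one hcont
    (show η ∈ _ by
      simp only [AffineMap.lineMap_apply_zero, AffineMap.lineMap_apply_one]
      exact ⟨by rw [Metric.infDist_zero_of_mem hq]; exact hη.le, hlt.le⟩)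
  have hδ : 0 < δ₀ / (p + 1) := by positivity
  have hbound : ∀ j, max (h (AffineMap.lineMap q x t) j) 0 ≤ δ₀ / (p + 1) := fun j => by
    refine max_le ?_ hδ.le
    have := (hconv j).2 (mem_univ q) (mem_univ x) (sub_nonneg.2 ht1) ht0 (by ring)
    rw [AffineMap.lineMap_apply_module]
    simp only [smul_eq_mul] at this
    have h1 : (1 - t) * h q j ≤ 0 := mul_nonpos_of_nonneg_of_nonpos (by linarith) (hq j)
    have h2 : t * h x j ≤ 1 * (δ₀ / (p + 1)) :=
      (mul_le_mul_of_nonneg_left (hx j) ht0).trans (mul_le_mul_of_nonneg_right ht1 hδ.le)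
    linarith
  have hsum := (hmin _ ht).trans (Finset.sum_le_sum fun j _ => hbound j)
  simp only [Finset.sum_const, Finset.card_univ, Fintype.card_fin, nsmul_eq_mul] at hsum
  have : (p : ℝ) * (δ₀ / (p + 1)) < δ₀ := by
    rw [mul_div_assoc', div_lt_iff₀ (by positivity)]
    nlinarith
  linarith

/-! ### The residual and the projection inequality. -/

theorem abs_apply_le_normInf {p : ℕ} (v : EuclideanSpace ℝ (Fin p)) (j : Fin p) :
    |v j| ≤ normInf v :=
  norm_le_pi_norm (WithLp.ofLp v) j

theorem normInf_nonneg {p : ℕ} (v : EuclideanSpace ℝ (Fin p)) : 0 ≤ normInf v := norm_nonneg _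

theorem norm_le_mul_normInf {p : ℕ} (v : EuclideanSpace ℝ (Fin p)) : ‖v‖ ≤ √p * normInf v := by
  refine (sq_le_sq₀ (norm_nonneg v) (mul_nonneg (Real.sqrt_nonneg _) (normInf_nonneg v))).1 ?_
  rw [EuclideanSpace.norm_sq_eq, mul_pow, Real.sq_sqrt (Nat.cast_nonneg p)]
  calc ∑ i, ‖v i‖ ^ 2 ≤ ∑ _i : Fin p, normInf v ^ 2 :=
        Finset.sum_le_sum fun i _ => pow_le_pow_left₀ (norm_nonneg _) (abs_apply_le_normInf v i) 2
    _ = _ := by simp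

section Residual

variable {m p : ℕ} {h : EuclideanSpace ℝ (Fin m) → EuclideanSpace ℝ (Fin p)}
  {x xt : EuclideanSpace ℝ (Fin m)} {lam : EuclideanSpace ℝ (Fin p)} {r : ℝ}

theorem normInf_posPart_le_of_residual_le (hr : residual h x lam xt ≤ r) :
    normInf (posPart (h x)) ≤ r := by
  unfold residual at hr
  have h1 := le_max_right (inner ℝ x (x - xt + jacobianMul h x lam)) 0
  have h2 := normInf_nonneg (x - xt + jacobianMul h x lam)
  have h3 := le_max_right (-(inner ℝ lam (h x))) 0
  linarith

theorem apply_le_of_residual_le (hr : residual h x lam xt ≤ r) (j : Fin p) : h x j ≤ r :=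
  (le_max_left _ 0).trans <| (le_abs_self _).trans <|
    (abs_apply_le_normInf (posPart (h x)) j).trans (normInf_posPart_le_of_residual_le hr)

/-- A point with small residual is an approximate solution of the variational inequality that
characterizes the projection of `xt` onto the feasible set. -/
theorem inner_le_of_residual_le (hdiff : Differentiable ℝ h)
    (hconv : ∀ j, ConvexOn ℝ univ fun w => h w j) (hlam : ∀ j, 0 ≤ lam j)
    (hr : residual h x lam xt ≤ r) {y : EuclideanSpace ℝ (Fin m)} (hy : y ∈ feasibleSet h) :
    inner ℝ (xt - x) (y - x) ≤ r * (1 + √m * ‖y‖) := by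
  have hjac : inner ℝ (jacobianMul h x lam) (y - x) ≤ -inner ℝ lam (h x) := by
    rw [jacobianMul, sum_inner, PiLp.inner_apply, ← Finset.sum_neg_distrib]
    refine Finset.sum_le_sum fun j _ => ?_
    have h1 := ConvexOn.add_inner_gradient_le (hconv j)
      (x := x) (by fun_prop) y
    have h2 := hy j
    rw [real_inner_smul_left]
    simp only [RCLike.inner_apply, conj_trivial]
    nlinarith [hlam j]
  set d := x - xt + jacobianMul h x lam with hd
  have hdy : -inner ℝ d y ≤ normInf d * (√m * ‖y‖) := by
    calc -inner ℝ d y ≤ ‖d‖ * ‖y‖ := (neg_le_abs _).trans (abs_real_inner_le_norm _ _)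
      _ ≤ (√m * normInf d) * ‖y‖ := by gcongr; exact norm_le_mul_normInf d
      _ = _ := by ring
  -- The three terms are controlled by the complementarity, inner product and sup-norm parts of the
  -- residual. Keeping `⟨x, d⟩` whole makes the bound independent of the size of `x`.
  have heq : inner ℝ (xt - x) (y - x)
      = inner ℝ (jacobianMul h x lam) (y - x) + inner ℝ x d - inner ℝ d y := by
    have : xt - x = jacobianMul h x lam - d := by rw [hd]; abel
    rw [this, inner_sub_left, inner_sub_right d, real_inner_comm d x]; ring
  have hunf : max (inner ℝ x d) 0 + normInf d + normInf (posPart (h x))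
      + max (-(inner ℝ lam (h x))) 0 ≤ r := hr
  have h1 := le_max_left (inner ℝ x d) 0
  have h1' := le_max_right (inner ℝ x d) 0
  have h2 := normInf_nonneg d
  have h3 := le_max_left (-(inner ℝ lam (h x))) 0
  have h3' := le_max_right (-(inner ℝ lam (h x))) 0
  have h4 := normInf_nonneg (posPart (h x))
  have h5 : normInf d * (√m * ‖y‖) ≤ r * (√m * ‖y‖) := by gcongr; linarith
  linarith

end Residual

/-! ### Block products and descent in one block. -/

theorem isCompact_blockProduct {n : ℕ} {m : Fin n → ℕ}
    {T : ∀ i, Set (EuclideanSpace ℝ (Fin (m i)))} (hT : ∀ i, IsCompact (T i)) :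
    IsCompact (blockProduct T) := by
  have : blockProduct T = WithLp.toLp 2 '' (univ.pi T) := by
    ext z
    constructor
    · exact fun hz => ⟨WithLp.ofLp z, fun i _ => hz i, rfl⟩
    · rintro ⟨y, hy, rfl⟩ i
      exact hy i (mem_univ i)
  rw [this]
  exact (isCompact_univ_pi hT).image (PiLp.continuous_toLp 2 _)

theorem convex_blockProduct {n : ℕ} {m : Fin n → ℕ}
    {T : ∀ i, Set (EuclideanSpace ℝ (Fin (m i)))} (hT : ∀ i, Convex ℝ (T i)) :
    Convex ℝ (blockProduct T) :=
  fun _ hx _ hy _ _ ha hb hab i => hT i (hx i) (hy i) ha hb hab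

/-- The descent inequality for a displacement `d` that is confined to one block. -/
theorem le_add_inner_blockGradient {n : ℕ} {m : Fin n → ℕ} {f : BlockSpace m → ℝ}
    (hf : Differentiable ℝ f) {T : ∀ i, Set (EuclideanSpace ℝ (Fin (m i)))}
    (hT : ∀ i, Convex ℝ (T i)) {Lip : Fin n → ℝ} (hLip : BlockLipschitzGradient f T Lip)
    {i : Fin n} {w d : BlockSpace m} (hw : w ∈ blockProduct T) (hwd : w + d ∈ blockProduct T)
    (hd : ∀ j ≠ i, d j = 0) :
    f (w + d) ≤ f w + inner ℝ (blockGradient f i w) (d i) + Lip i * ‖d i‖ ^ 2 := by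
  have hinner : ∀ u, inner ℝ (gradient f u) d = inner ℝ (blockGradient f i u) (d i) := fun u => by
    rw [PiLp.inner_apply, Finset.sum_eq_single i (fun j _ hj => by simp [hd j hj]) (by simp)]
    rfl
  have hnorm : ‖d‖ = ‖d i‖ := by
    rw [← sq_eq_sq₀ (norm_nonneg _) (norm_nonneg _), PiLp.norm_sq_eq_of_L2,
      Finset.sum_eq_single i (fun j _ hj => by simp [hd j hj]) (by simp)]
  have hder : ∀ t : ℝ, HasDerivAt (fun t : ℝ => f (w + t • d))
      (inner ℝ (blockGradient f i (w + t • d)) (d i)) t := fun t => by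
    rw [← hinner, inner_gradient_left]
    have h1 : HasDerivAt (fun t : ℝ => w + t • d) d t := by
      simpa using ((hasDerivAt_id t).smul_const d).const_add w
    exact (hf (w + t • d)).hasFDerivAt.comp_hasDerivAt t h1
  -- The mean value theorem gives the factor `Lip i` instead of `Lip i / 2`. This suffices, because
  -- the projection inequality later supplies the full `τ ‖d i‖ ^ 2`.
  obtain ⟨c, ⟨hc0, hc1⟩, hc⟩ := exists_hasDerivAt_eq_slope (fun t : ℝ => f (w + t • d)) _ one_pos
    (fun t _ => (hder t).continuousAt.continuousWithinAt) (fun t _ => hder t)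
  simp only [one_smul, zero_smul, add_zero, sub_zero, div_one] at hc
  have hmem : w + c • d ∈ blockProduct T := by
    have := (convex_blockProduct hT).add_smul_sub_mem hw hwd ⟨hc0.le, hc1.le⟩
    simpa using this
  have hlip := (hLip i).2 _ hmem _ hw
  rw [add_sub_cancel_left, norm_smul, Real.norm_of_nonneg hc0.le, hnorm] at hlip
  have h1 : inner ℝ (blockGradient f i (w + c • d) - blockGradient f i w) (d i)
      ≤ Lip i * ‖d i‖ ^ 2 := by
    calc _ ≤ ‖blockGradient f i (w + c • d) - blockGradient f i w‖ * ‖d i‖ :=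
          real_inner_le_norm _ _
      _ ≤ (Lip i * (c * ‖d i‖)) * ‖d i‖ := by gcongr
      _ ≤ (Lip i * (1 * ‖d i‖)) * ‖d i‖ := by
          have := (hLip i).1
          gcongr
      _ = _ := by ring
  rw [inner_sub_left] at h1
  linarith

/-! ### Accumulation points of sequences. -/

theorem accumulationPoints_eq {E : Type*} [TopologicalSpace E] [FirstCountableTopology E]
    (z : ℕ → E) : accumulationPoints z = {a | MapClusterPt a atTop z} := by
  ext a
  constructor
  · rintro ⟨φ, hφ, hlim⟩
    exact MapClusterPt.of_comp hφ.tendsto_atTop hlim.mapClusterPt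
  · exact fun ha => MapClusterPt.tendsto_subseq ha

section ClusterPoints

variable {E : Type*} [MetricSpace E] {K : Set E} {z : ℕ → E}

/-- Otherwise the sequence would visit the compact set `K \ U` infinitely often and accumulate
there. -/
theorem eventually_mem_of_accumulationPoints_subset (hK : IsCompact K)
    (hz : ∀ᶠ k in atTop, z k ∈ K) {U : Set E} (hU : IsOpen U)
    (hsub : accumulationPoints z ⊆ U) : ∀ᶠ k in atTop, z k ∈ U := by
  by_contra hcon
  obtain ⟨a, ha, hacc⟩ := (hK.diff hU).exists_mapClusterPt_of_frequently
    (((not_eventually.1 hcon).and_eventually hz).mono fun k hk => ⟨hk.2, hk.1⟩)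
  exact ha.2 (hsub (by rw [accumulationPoints_eq]; exact hacc))

theorem accumulationPoints_nonempty (hK : IsCompact K) (hz : ∀ᶠ k in atTop, z k ∈ K) :
    (accumulationPoints z).Nonempty := by
  obtain ⟨a, -, ha⟩ := hK.exists_mapClusterPt (le_principal_iff.2 hz)
  exact ⟨a, by rw [accumulationPoints_eq]; exact ha⟩

theorem accumulationPoints_subset_of_isClosed (hK : IsClosed K) (hz : ∀ᶠ k in atTop, z k ∈ K) :
    accumulationPoints z ⊆ K := by
  rintro a ⟨φ, hφ, hlim⟩
  exact hK.mem_of_tendsto hlim (hφ.tendsto_atTop.eventually hz)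

theorem isCompact_accumulationPoints (hK : IsCompact K) (hz : ∀ᶠ k in atTop, z k ∈ K) :
    IsCompact (accumulationPoints z) := by
  refine hK.of_isClosed_subset ?_ (accumulationPoints_subset_of_isClosed hK.isClosed hz)
  rw [accumulationPoints_eq]
  exact isClosed_setOfPred_clusterPt

theorem tendsto_infDist_accumulationPoints (hK : IsCompact K) (hz : ∀ᶠ k in atTop, z k ∈ K) :
    Tendsto (fun k => Metric.infDist (z k) (accumulationPoints z)) atTop (𝓝 0) := by
  refine tendsto_order.2 ⟨fun b hb => Eventually.of_forall fun k =>
    hb.trans_le Metric.infDist_nonneg, fun b hb => ?_⟩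
  refine (eventually_mem_of_accumulationPoints_subset hK hz Metric.isOpen_thickening
    (Metric.self_subset_thickening hb _)).mono fun k hk => ?_
  obtain ⟨a, ha, hd⟩ := Metric.mem_thickening_iff.1 hk
  exact (Metric.infDist_le_dist_of_mem ha).trans_lt hd

/-- Ostrowski's theorem: the accumulation points of a sequence with relatively compact range and
vanishing increments form a connected set. -/
theorem isConnected_accumulationPoints (hK : IsCompact K) (hz : ∀ᶠ k in atTop, z k ∈ K)
    (hinc : Tendsto (fun k => dist (z (k + 1)) (z k)) atTop (𝓝 0)) :
    IsConnected (accumulationPoints z) := by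
  refine ⟨accumulationPoints_nonempty hK hz, isPreconnected_closed_iff.2 ?_⟩
  intro t t' ht ht' hsub hne hne'
  by_contra hemp
  rw [not_nonempty_iff_eq_empty] at hemp
  have hΩ := isCompact_accumulationPoints hK hz
  have hdisj : Disjoint (accumulationPoints z ∩ t) (accumulationPoints z ∩ t') := by
    rw [disjoint_iff_inter_eq_empty, ← inter_inter_distrib_left, hemp]
  obtain ⟨δ, hδ, hthick⟩ := hdisj.exists_thickenings (hΩ.inter_right ht)
    (hΩ.inter_right ht').isClosed
  -- Neighbourhoods of half the separating radius leave room for one increment below `δ / 2`, so the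
  -- sequence cannot jump from one to the other.
  have hhalf : 0 < δ / 2 := half_pos hδ
  have hev := eventually_mem_of_accumulationPoints_subset hK hz
    (Metric.isOpen_thickening.union Metric.isOpen_thickening)
    (show accumulationPoints z ⊆ Metric.thickening (δ / 2) (accumulationPoints z ∩ t) ∪
        Metric.thickening (δ / 2) (accumulationPoints z ∩ t') from fun a ha =>
      (hsub ha).imp (fun h => Metric.self_subset_thickening hhalf _ ⟨ha, h⟩)
        (fun h => Metric.self_subset_thickening hhalf _ ⟨ha, h⟩))
  have hfreq : ∀ s : Set E, (accumulationPoints z ∩ s).Nonempty →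
      ∃ᶠ k in atTop, z k ∈ Metric.thickening (δ / 2) (accumulationPoints z ∩ s) := by
    rintro s ⟨a, ha, has⟩
    have ha' : MapClusterPt a atTop z := by rwa [accumulationPoints_eq] at ha
    exact ha'.frequently (Metric.isOpen_thickening.mem_nhds
      (Metric.self_subset_thickening hhalf _ ⟨ha, has⟩))
  obtain ⟨N, hN⟩ := eventually_atTop.1 (hev.and (hinc.eventually_lt_const hhalf))
  obtain ⟨k₀, hk₀, hmem⟩ := (frequently_atTop.1 (hfreq t hne)) N
  have hstay : ∀ k ≥ k₀, z k ∈ Metric.thickening (δ / 2) (accumulationPoints z ∩ t) := by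
    intro k hk
    induction k, hk using Nat.le_induction with
    | base => exact hmem
    | succ k hk ih =>
      refine ((hN (k + 1) (by omega)).1).resolve_right fun hr => ?_
      obtain ⟨b, hb, hbd⟩ := Metric.mem_thickening_iff.1 hr
      have hkd := (hN k (by omega)).2
      refine disjoint_left.1 hthick (Metric.thickening_mono (by linarith) _ ih)
        (Metric.mem_thickening_iff.2 ⟨b, hb, ?_⟩)
      rw [dist_comm] at hkd
      linarith [dist_triangle (z k) (z (k + 1)) b]
  obtain ⟨k₁, hk₁, hmem₁⟩ := (frequently_atTop.1 (hfreq t' hne')) k₀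
  exact disjoint_left.1 hthick (Metric.thickening_mono (by linarith) _ (hstay k₁ hk₁))
    (Metric.thickening_mono (by linarith) _ hmem₁)

end ClusterPoints

/-! ### Descent with summable errors. -/

/-- A sequence that decreases up to summable errors converges, and its decrements vanish. -/
theorem tendsto_of_descent {a b s : ℕ → ℝ} {c B : ℝ} (hc : 0 < c) (hs : Summable s)
    (hs0 : ∀ k, 0 ≤ s k) (hb : ∀ k, 0 ≤ b k) (ha : ∀ k, B ≤ a k)
    (hdesc : ∀ k, a (k + 1) ≤ a k + s k - c * b k) :
    (∃ l, Tendsto a atTop (𝓝 l)) ∧ Tendsto b atTop (𝓝 0) := by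
  -- Subtracting the accumulated errors restores monotonicity.
  have hanti : Antitone fun k => a k - ∑ i ∈ Finset.range k, s i := by
    refine antitone_nat_of_succ_le fun k => ?_
    rw [Finset.sum_range_succ]
    linarith [hdesc k, mul_nonneg hc.le (hb k)]
  have hbdd : BddBelow (range fun k => a k - ∑ i ∈ Finset.range k, s i) := by
    refine ⟨B - ∑' i, s i, ?_⟩
    rintro _ ⟨k, rfl⟩
    exact sub_le_sub (ha k) (hs.sum_le_tsum _ fun i _ => hs0 i)
  have hlim := (tendsto_atTop_ciInf hanti hbdd).add hs.hasSum.tendsto_sum_nat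
  simp only [sub_add_cancel] at hlim
  refine ⟨⟨_, hlim⟩, ?_⟩
  have hup : Tendsto (fun k => (a k - a (k + 1) + s k) / c) atTop (𝓝 0) := by
    simpa using ((hlim.sub ((tendsto_add_atTop_iff_nat 1).2 hlim)).add
      hs.tendsto_atTop_zero).div_const c
  refine squeeze_zero hb (fun k => ?_) hup
  rw [le_div_iff₀ hc]
  linarith [hdesc k]

/-! ### The extended objective and stationarity. -/

theorem indicatorFun_of_mem {E : Type*} {S : Set E} {w : E} (hw : w ∈ S) :
    indicatorFun S w = 0 := if_pos hw

theorem indicatorFun_of_notMem {E : Type*} {S : Set E} {w : E} (hw : w ∉ S) :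
    indicatorFun S w = ⊤ := if_neg hw

theorem indicatorFun_nonneg {E : Type*} (S : Set E) (w : E) : 0 ≤ indicatorFun S w := by
  by_cases hw : w ∈ S
  · rw [indicatorFun_of_mem hw]
  · rw [indicatorFun_of_notMem hw]; exact le_top

section Objective

variable {n : ℕ} {m : Fin n → ℕ} {f : BlockSpace m → ℝ}
  {S : ∀ i, Set (EuclideanSpace ℝ (Fin (m i)))}

theorem extendedObjective_of_mem {z : BlockSpace m} (hz : z ∈ blockProduct S) :
    extendedObjective f S z = f z := by
  simp [extendedObjective, fun i => indicatorFun_of_mem (hz i)]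

theorem extendedObjective_of_notMem {z : BlockSpace m} (hz : z ∉ blockProduct S) :
    extendedObjective f S z = ⊤ := by
  obtain ⟨i, hi⟩ : ∃ i, z i ∉ S i := by
    by_contra! hcon
    exact hz hcon
  have : ∑ i, indicatorFun (S i) (z i) = ⊤ := by
    refine top_le_iff.1 ?_
    rw [← indicatorFun_of_notMem hi]
    exact Finset.single_le_sum (f := fun j => indicatorFun (S j) (z j))
      (fun j _ => indicatorFun_nonneg _ _) (Finset.mem_univ i)
  rw [extendedObjective, this, EReal.coe_add_top]

/-- A feasible point that solves the blockwise variational inequality is stationary. -/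
theorem isStationary_of_forall_inner_nonneg (hf : Differentiable ℝ f) {a : BlockSpace m}
    (ha : a ∈ blockProduct S)
    (hvi : ∀ i, ∀ y ∈ S i, 0 ≤ inner ℝ (blockGradient f i a) (y - a i)) :
    IsStationary (extendedObjective f S) a := by
  refine ⟨by rw [extendedObjective_of_mem ha]; exact EReal.coe_lt_top _, ?_⟩
  rw [le_liminf_iff]
  intro b hb
  -- This `ε` is negative. Near `a` the quotient is at least `ε` on the feasible set, by
  -- differentiability and the variational inequality, and is `⊤` off it.
  obtain ⟨ε, hbε, hε⟩ := EReal.lt_iff_exists_real_btwn.1 hb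
  have hε0 : 0 < -ε := by simpa using hε
  have hlittle := (hasGradientAt_iff_isLittleO.1 (hf a).hasGradientAt).def hε0
  filter_upwards [nhdsWithin_le_nhds hlittle, self_mem_nhdsWithin] with y hy hya
  have hpos : 0 < ‖y - a‖ := norm_pos_iff.2 (sub_ne_zero.2 hya)
  refine hbε.trans_le ?_
  by_cases hyS : y ∈ blockProduct S
  · rw [extendedObjective_of_mem ha, extendedObjective_of_mem hyS, inner_zero_left,
      ← EReal.coe_sub, ← EReal.coe_sub, ← EReal.coe_div, EReal.coe_le_coe_iff, le_div_iff₀ hpos,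
      sub_zero]
    have hin : 0 ≤ inner ℝ (gradient f a) (y - a) := by
      rw [PiLp.inner_apply]
      exact Finset.sum_nonneg fun i _ => hvi i (y i) (hyS i)
    have := (abs_le.1 hy).1
    linarith
  · rw [extendedObjective_of_mem ha, extendedObjective_of_notMem hyS, inner_zero_left,
      EReal.top_sub_coe, EReal.top_sub_coe,
      EReal.top_div_of_pos_ne_top (by exact_mod_cast hpos) (EReal.coe_ne_top _)]
    exact le_top

end Objective

/-! ### Block sweeps and exact subproblems. -/

section Mixed

variable {n : ℕ} {m : Fin n → ℕ}

theorem norm_mixed_sub_le (i : Fin n) (x y : BlockSpace m) : ‖mixed i x y - y‖ ≤ ‖x - y‖ := by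
  rw [← sq_le_sq₀ (norm_nonneg _) (norm_nonneg _), PiLp.norm_sq_eq_of_L2, PiLp.norm_sq_eq_of_L2]
  refine Finset.sum_le_sum fun j _ => ?_
  by_cases hj : j < i <;> simp [mixed, hj]

theorem mixed_mem_blockProduct {T : ∀ i, Set (EuclideanSpace ℝ (Fin (m i)))} (i : Fin n)
    {x y : BlockSpace m} (hx : x ∈ blockProduct T) (hy : y ∈ blockProduct T) :
    mixed i x y ∈ blockProduct T := fun j => by
  by_cases hj : j < i
  · simpa [mixed, hj] using hx j
  · simpa [mixed, hj] using hy j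

/-- A function that decreases along each block update decreases along the whole sweep. -/
theorem apply_le_of_forall_mixed {f : BlockSpace m → ℝ} {x y : BlockSpace m} {e : Fin n → ℝ}
    (hstep : ∀ i, ∀ w, (∀ j ≠ i, w j = mixed i x y j) → w i = x i →
      f w ≤ f (mixed i x y) + e i) :
    f x ≤ f y + ∑ i, e i := by
  -- `W t` has its first `t` blocks updated, so the change over the sweep telescopes.
  set W : ℕ → BlockSpace m := fun t => WithLp.toLp 2 fun j => if (j : ℕ) < t then x j else y j
    with hW
  have hW0 : W 0 = y := by ext j; simp [hW]
  have hWn : W n = x := by ext j; simp [hW]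
  have hWi : ∀ i : Fin n, W i = mixed i x y := fun i => rfl
  have hsum : ∑ i : Fin n, (f (W (i + 1)) - f (W i)) = f x - f y := by
    rw [Fin.sum_univ_eq_sum_range (fun t => f (W (t + 1)) - f (W t)), 
      Finset.sum_range_sub fun t => f (W t), hW0, hWn]
  have hle : ∑ i : Fin n, (f (W (i + 1)) - f (W i)) ≤ ∑ i, e i := by
    refine Finset.sum_le_sum fun i _ => ?_
    have := hstep i (W (i + 1)) (fun j hj => ?_) (by simp [hW])
    · rw [hWi]; linarith
    · simp [hW, mixed, hj.le_iff_lt]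
  linarith

end Mixed

/-- The exact subproblem solution satisfies the variational inequality of a projection. -/
theorem inner_le_zero_of_isMinOn {n : ℕ} {m : Fin n → ℕ} {f : BlockSpace m → ℝ} {σ : ℝ}
    (hσ : 0 < σ) {i : Fin n} {znext z : BlockSpace m} {S : Set (EuclideanSpace ℝ (Fin (m i)))}
    (hS : Convex ℝ S) {x : EuclideanSpace ℝ (Fin (m i))} (hx : x ∈ S)
    (hmin : IsMinOn (subproblemObjective f σ i znext z) S x)
    {y : EuclideanSpace ℝ (Fin (m i))} (hy : y ∈ S) :
    inner ℝ (gradientStep f σ i znext z - x) (y - x) ≤ 0 := by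
  -- Completing the square: minimizing the subproblem objective means projecting the gradient step.
  have hsq : ∀ w, ‖gradientStep f σ i znext z - w‖ ^ 2
      = 2 / σ * subproblemObjective f σ i znext z w
        + (1 / σ) ^ 2 * ‖blockGradient f i (mixed i znext z)‖ ^ 2 := fun w => by
    set g := blockGradient f i (mixed i znext z) with hg
    have : gradientStep f σ i znext z - w = -((w - z i) + (1 / σ) • g) := by
      rw [gradientStep]; abel
    rw [this, norm_neg, norm_add_sq_real, real_inner_smul_right, norm_smul, mul_pow,
      subproblemObjective, real_inner_comm, ← hg, Real.norm_eq_abs, sq_abs]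
    field_simp
    ring
  have hle : ∀ w ∈ S, ‖gradientStep f σ i znext z - x‖ ≤ ‖gradientStep f σ i znext z - w‖ :=
    fun w hw => by
      rw [← sq_le_sq₀ (norm_nonneg _) (norm_nonneg _), hsq, hsq]
      have := hmin hw
      gcongr
      exact this
  have : Nonempty S := ⟨⟨x, hx⟩⟩
  refine (norm_eq_iInf_iff_real_inner_le_zero hS hx).1 (le_antisymm ?_ ?_) y hy
  · exact le_ciInf fun w => hle w w.2
  · exact ciInf_le ⟨0, by rintro _ ⟨w, rfl⟩; exact norm_nonneg _⟩ (⟨x, hx⟩ : S)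

theorem exists_norm_blockGradient_le {n : ℕ} {m : Fin n → ℕ} {f : BlockSpace m → ℝ}
    {T : ∀ i, Set (EuclideanSpace ℝ (Fin (m i)))} {Lip : Fin n → ℝ}
    (hT : ∀ i, IsCompact (T i)) (hLip : BlockLipschitzGradient f T Lip) :
    ∃ G : ℝ, ∀ i, ∀ w ∈ blockProduct T, ‖blockGradient f i w‖ ≤ G := by
  suffices hbdd : ∀ i, ∃ G : ℝ, ∀ w ∈ blockProduct T, ‖blockGradient f i w‖ ≤ G by
    choose G hG using hbdd
    obtain ⟨G', hG'⟩ := Finite.exists_le G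
    exact ⟨G', fun i w hw => (hG i w hw).trans (hG' i)⟩
  intro i
  have hcont : ContinuousOn (fun w => blockGradient f i w) (blockProduct T) :=
    (LipschitzOnWith.of_dist_le_mul (K := ⟨Lip i, (hLip i).1.le⟩) fun x hx y hy => by
      rw [dist_eq_norm, dist_eq_norm]; exact (hLip i).2 x hx y hy).continuousOn
  exact ((isCompact_blockProduct hT).image_of_continuousOn hcont).isBounded.exists_norm_le.imp
    fun G hG w hw => hG _ (mem_image_of_mem _ hw)

/-! ### Approximate runs: descent and limits. -/

/-- A sequence `u` that stays in the product of the sets `T i`, whose distance to the product of the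
sets `S i` is controlled by summable errors `δ k`, and whose steps solve the variational inequalities
of the subproblems up to `δ k`. -/
structure IsApproximateRun {n : ℕ} {m : Fin n → ℕ} (f : BlockSpace m → ℝ)
    (S T : ∀ i, Set (EuclideanSpace ℝ (Fin (m i)))) (Lip : Fin n → ℝ) (L Ml Mu : ℝ)
    (τ : ℕ → Fin n → ℝ) (δ : ℕ → ℝ) (u : ℕ → BlockSpace m) : Prop where
  differentiable : Differentiable ℝ f
  isCompact_S : ∀ i, IsCompact (S i)
  nonempty_S : ∀ i, (S i).Nonempty
  subset : ∀ i, S i ⊆ T i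
  convex_T : ∀ i, Convex ℝ (T i)
  isCompact_T : ∀ i, IsCompact (T i)
  lipschitz : BlockLipschitzGradient f T Lip
  Lip_le : ∀ i, Lip i ≤ L
  L_lt : L < Ml
  Ml_pos : 0 < Ml
  tau_mem : ∀ k i, τ k i ∈ Icc Ml Mu
  mem : ∀ k, u k ∈ blockProduct T
  err_nonneg : ∀ k, 0 ≤ δ k
  err_summable : Summable δ
  infDist_le : ∀ k i, Metric.infDist (u k i) (S i) ≤ δ k
  infDist_succ_le : ∀ k i, Metric.infDist (u (k + 1) i) (S i) ≤ δ k
  inner_le : ∀ k i, ∀ y ∈ S i,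
    inner ℝ (gradientStep f (τ k i) i (u (k + 1)) (u k) - u (k + 1) i) (y - u (k + 1) i) ≤ δ k

namespace IsApproximateRun

variable {n : ℕ} {m : Fin n → ℕ} {f : BlockSpace m → ℝ}
  {S T : ∀ i, Set (EuclideanSpace ℝ (Fin (m i)))} {Lip : Fin n → ℝ} {L Ml Mu : ℝ}
  {τ : ℕ → Fin n → ℝ} {δ : ℕ → ℝ} {u : ℕ → BlockSpace m}

theorem tau_pos (H : IsApproximateRun f S T Lip L Ml Mu τ δ u) (k : ℕ) (i : Fin n) :
    0 < τ k i := H.Ml_pos.trans_le (H.tau_mem k i).1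

/-- This `D` prices infeasibility: replacing an iterate by its nearest feasible point changes the
inner products by at most `D * δ k`. -/
theorem exists_norm_gradientStep_sub_le (H : IsApproximateRun f S T Lip L Ml Mu τ δ u) :
    ∃ D : ℝ, 0 ≤ D ∧ ∀ k i, ∀ w ∈ T i,
      ‖gradientStep f (τ k i) i (u (k + 1)) (u k) - w‖ ≤ D := by
  choose R hR using fun i => (H.isCompact_T i).isBounded.exists_norm_le
  obtain ⟨R', hR'⟩ := Finite.exists_le R
  obtain ⟨G, hG⟩ := exists_norm_blockGradient_le H.isCompact_T H.lipschitz
  have key : ∀ k i, ∀ w ∈ T i,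
      ‖gradientStep f (τ k i) i (u (k + 1)) (u k) - w‖ ≤ R' + 1 / Ml * G + R' := by
    intro k i w hw
    have h1 := (hR i _ (H.mem k i)).trans (hR' i)
    have h2 := (hR i w hw).trans (hR' i)
    have h3 := hG i _ (mixed_mem_blockProduct i (H.mem (k + 1)) (H.mem k))
    have hτ := H.tau_pos k i
    have h4 : ‖(1 / τ k i) • blockGradient f i (mixed i (u (k + 1)) (u k))‖ ≤ 1 / Ml * G := by
      rw [norm_smul, Real.norm_of_nonneg (by positivity)]
      have := H.Ml_pos
      have := (H.tau_mem k i).1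
      gcongr
    exact (norm_sub_le _ _).trans (add_le_add ((norm_sub_le _ _).trans (add_le_add h1 h4)) h2)
  exact ⟨max (R' + 1 / Ml * G + R') 0, le_max_right _ _,
    fun k i w hw => (key k i w hw).trans (le_max_left _ _)⟩

/-- The projection inequality is tested at the point of `S i` nearest to the old block. Multiplied
by `τ k i`, it bounds `τ ‖Δ‖ ^ 2 + ⟨g, Δ⟩` by an error, `Δ` being the block increment and `g` the
partial gradient; inserted in the one-block descent inequality, this leaves `(Lip i - τ) ‖Δ‖ ^ 2`.
-/
theorem descent (H : IsApproximateRun f S T Lip L Ml Mu τ δ u) :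
    ∃ C : ℝ, 0 ≤ C ∧ ∀ k,
      f (u (k + 1)) ≤ f (u k) + C * δ k - (Ml - L) * ‖u (k + 1) - u k‖ ^ 2 := by
  obtain ⟨D, hD0, hD⟩ := H.exists_norm_gradientStep_sub_le
  refine ⟨n * (|Mu| * (1 + D)), by positivity, fun k => ?_⟩
  have hstep := apply_le_of_forall_mixed (f := f) (x := u (k + 1)) (y := u k)
    (e := fun i => |Mu| * (1 + D) * δ k - (Ml - L) * ‖u (k + 1) i - u k i‖ ^ 2) ?_
  · rw [Finset.sum_sub_distrib, 
      ← Finset.mul_sum _ fun i => ‖u (k + 1) i - u k i‖ ^ 2] at hstep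
    rw [PiLp.norm_sq_eq_of_L2]
    simp only [Finset.sum_const, Finset.card_univ, Fintype.card_fin, nsmul_eq_mul] at hstep
    simp only [PiLp.sub_apply]
    linarith
  intro i w hw hwi
  set v := mixed i (u (k + 1)) (u k) with hv
  have hvT : v ∈ blockProduct T := mixed_mem_blockProduct i (H.mem (k + 1)) (H.mem k)
  have hvi : v i = u k i := by simp [hv, mixed]
  have hwT : w ∈ blockProduct T := fun j => by
    by_cases hj : j = i
    · subst hj; rw [hwi]; exact H.mem (k + 1) j
    · rw [hw j hj]; exact hvT j
  have hdesc := le_add_inner_blockGradient H.differentiable H.convex_T H.lipschitz (i := i)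
    (w := v) (d := w - v) hvT (by simpa using hwT) (fun j hj => by simp [hw j hj])
  rw [add_sub_cancel, PiLp.sub_apply, hwi, hvi] at hdesc
  obtain ⟨q, hq, hqd⟩ := (H.isCompact_S i).exists_infDist_eq_dist (H.nonempty_S i) (u k i)
  set xt := gradientStep f (τ k i) i (u (k + 1)) (u k) with hxt
  have hproj : inner ℝ (xt - u (k + 1) i) (u k i - u (k + 1) i) ≤ (1 + D) * δ k := by
    have h1 := H.inner_le k i q hq
    have h2 : inner ℝ (xt - u (k + 1) i) (u k i - q) ≤ D * δ k := by
      refine (real_inner_le_norm _ _).trans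
        (mul_le_mul (hD k i _ (H.mem (k + 1) i)) ?_ (norm_nonneg _) hD0)
      rw [← dist_eq_norm, ← hqd]
      exact H.infDist_le k i
    have h3 : u k i - u (k + 1) i = (q - u (k + 1) i) + (u k i - q) := by abel
    rw [h3, inner_add_right]
    linarith
  have hτ := H.tau_pos k i
  have hexp : τ k i * inner ℝ (xt - u (k + 1) i) (u k i - u (k + 1) i)
      = τ k i * ‖u (k + 1) i - u k i‖ ^ 2
        + inner ℝ (blockGradient f i v) (u (k + 1) i - u k i) := by
    have h1 : xt - u (k + 1) i
        = (u k i - u (k + 1) i) - (1 / τ k i) • blockGradient f i v := by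
      rw [hxt, gradientStep]; abel
    rw [h1, inner_sub_left, real_inner_self_eq_norm_sq, real_inner_smul_left,
      norm_sub_rev, ← neg_sub (u (k + 1) i) (u k i), inner_neg_right]
    field_simp
    ring
  have hup : τ k i * inner ℝ (xt - u (k + 1) i) (u k i - u (k + 1) i)
      ≤ |Mu| * ((1 + D) * δ k) := by
    have h0 : 0 ≤ (1 + D) * δ k := mul_nonneg (by linarith) (H.err_nonneg k)
    calc _ ≤ τ k i * ((1 + D) * δ k) := by gcongr
      _ ≤ |Mu| * ((1 + D) * δ k) := by
        gcongr
        exact (H.tau_mem k i).2.trans (le_abs_self _)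
  have hsq : (Lip i - τ k i) * ‖u (k + 1) i - u k i‖ ^ 2
      ≤ (L - Ml) * ‖u (k + 1) i - u k i‖ ^ 2 := by
    have := H.Lip_le i
    have := (H.tau_mem k i).1
    gcongr
  linarith

theorem tendsto_values (H : IsApproximateRun f S T Lip L Ml Mu τ δ u) :
    (∃ c, Tendsto (fun k => f (u k)) atTop (𝓝 c)) ∧
      Tendsto (fun k => u (k + 1) - u k) atTop (𝓝 0) := by
  obtain ⟨C, hC, hdesc⟩ := H.descent
  obtain ⟨B, hB⟩ := ((isCompact_blockProduct H.isCompact_T).image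
    H.differentiable.continuous).bddBelow
  obtain ⟨h1, h2⟩ := tendsto_of_descent (sub_pos.2 H.L_lt) (H.err_summable.mul_left C)
    (fun k => mul_nonneg hC (H.err_nonneg k)) (fun k => sq_nonneg ‖u (k + 1) - u k‖)
    (fun k => hB ⟨_, H.mem k, rfl⟩) hdesc
  refine ⟨h1, tendsto_zero_iff_norm_tendsto_zero.2 ?_⟩
  simpa [Real.sqrt_sq (norm_nonneg _)] using h2.sqrt

/-- The iterates approach the exact subproblem solutions. -/
theorem tendsto_sub_exact (H : IsApproximateRun f S T Lip L Ml Mu τ δ u)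
    {ubar : ℕ → BlockSpace m} (hubar : ∀ k, ubar k ∈ blockProduct S)
    (hvi : ∀ k i, ∀ y ∈ S i,
      inner ℝ (gradientStep f (τ k i) i (u (k + 1)) (u k) - ubar k i) (y - ubar k i) ≤ 0) :
    Tendsto (fun k => u (k + 1) - ubar k) atTop (𝓝 0) := by
  obtain ⟨D, hD0, hD⟩ := H.exists_norm_gradientStep_sub_le
  have hblock : ∀ k i, ‖u (k + 1) i - ubar k i‖ ^ 2 ≤ (1 + D) * δ k := by
    intro k i
    set xt := gradientStep f (τ k i) i (u (k + 1)) (u k)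
    obtain ⟨q, hq, hqd⟩ := (H.isCompact_S i).exists_infDist_eq_dist (H.nonempty_S i) (u (k + 1) i)
    have h1 := H.inner_le k i _ (hubar k i)
    have h2 := hvi k i q hq
    have h3 : inner ℝ (xt - ubar k i) (u (k + 1) i - q) ≤ D * δ k := by
      refine (real_inner_le_norm _ _).trans
        (mul_le_mul (hD k i _ (H.subset i (hubar k i))) ?_ (norm_nonneg _) hD0)
      rw [← dist_eq_norm, ← hqd]
      exact H.infDist_succ_le k i
    -- Both points approximately project the same `xt`; each inequality is tested at the other
    -- point, with `q` standing in for the infeasible iterate.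
    have h4 : ‖u (k + 1) i - ubar k i‖ ^ 2
        = inner ℝ (xt - ubar k i) (q - ubar k i) + inner ℝ (xt - ubar k i) (u (k + 1) i - q)
          + inner ℝ (xt - u (k + 1) i) (ubar k i - u (k + 1) i) := by
      rw [← inner_add_right, sub_add_sub_cancel', ← neg_sub (u (k + 1) i) (ubar k i),
        inner_neg_right, ← sub_eq_add_neg, ← inner_sub_left, sub_sub_sub_cancel_left,
        real_inner_self_eq_norm_sq]
    linarith
  refine tendsto_zero_iff_norm_tendsto_zero.2 ?_
  have hsq : Tendsto (fun k => ‖u (k + 1) - ubar k‖ ^ 2) atTop (𝓝 0) := by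
    refine squeeze_zero (fun k => sq_nonneg _) (fun k => ?_)
      (g := fun k => n * ((1 + D) * δ k)) ?_
    · rw [PiLp.norm_sq_eq_of_L2]
      refine (Finset.sum_le_sum fun i _ => hblock k i).trans_eq ?_
      simp
    · simpa using (H.err_summable.tendsto_atTop_zero.const_mul (1 + D)).const_mul (n : ℝ)
  simpa [Real.sqrt_sq (norm_nonneg _)] using hsq.sqrt

theorem mem_of_tendsto (H : IsApproximateRun f S T Lip L Ml Mu τ δ u) {a : BlockSpace m}
    {φ : ℕ → ℕ} (hφ : Tendsto φ atTop atTop) (ha : Tendsto (u ∘ φ) atTop (𝓝 a)) :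
    a ∈ blockProduct S := by
  intro i
  have hcoord : Tendsto (fun k => u (φ k) i) atTop (𝓝 (a i)) :=
    ((PiLp.continuous_apply 2 _ i).tendsto a).comp ha
  have h1 := ((Metric.continuous_infDist_pt (S i)).tendsto (a i)).comp hcoord
  have h2 := le_of_tendsto_of_tendsto' h1 (H.err_summable.tendsto_atTop_zero.comp hφ)
    fun k => H.infDist_le (φ k) i
  exact ((H.isCompact_S i).isClosed.mem_iff_infDist_zero (H.nonempty_S i)).2
    (le_antisymm h2 Metric.infDist_nonneg)

/-- Multiplying the approximate inequality by `τ` isolates the gradient term; the remaining terms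
are at most `|Mu|` times a null sequence, so the parameters `τ` need not converge. -/
theorem inner_nonneg_of_tendsto (H : IsApproximateRun f S T Lip L Ml Mu τ δ u)
    {a : BlockSpace m} {φ : ℕ → ℕ} (hφ : Tendsto φ atTop atTop)
    (ha : Tendsto (u ∘ φ) atTop (𝓝 a)) (i : Fin n) {y : EuclideanSpace ℝ (Fin (m i))}
    (hy : y ∈ S i) : 0 ≤ inner ℝ (blockGradient f i a) (y - a i) := by
  have haT : a ∈ blockProduct T := fun j => H.subset j (H.mem_of_tendsto hφ ha j)
  have hinc : Tendsto (fun k => u (φ k + 1) - u (φ k)) atTop (𝓝 0) := H.tendsto_values.2.comp hφ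
  have hnext : Tendsto (fun k => u (φ k + 1)) atTop (𝓝 a) := by
    simpa using hinc.add ha
  have hmix : Tendsto (fun k => mixed i (u (φ k + 1)) (u (φ k))) atTop (𝓝 a) := by
    have : Tendsto (fun k => mixed i (u (φ k + 1)) (u (φ k)) - u (φ k)) atTop (𝓝 0) :=
      squeeze_zero_norm (fun k => norm_mixed_sub_le i _ _) (tendsto_zero_iff_norm_tendsto_zero.1 hinc)
    simpa using this.add ha
  have hgrad : Tendsto (fun k => blockGradient f i (mixed i (u (φ k + 1)) (u (φ k)))) atTop
      (𝓝 (blockGradient f i a)) := by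
    rw [tendsto_iff_norm_sub_tendsto_zero] at hmix ⊢
    refine squeeze_zero (fun k => norm_nonneg _) (fun k => (H.lipschitz i).2 _
      (mixed_mem_blockProduct i (H.mem _) (H.mem _)) _ haT) ?_
    simpa using hmix.const_mul (Lip i)
  have hcoord : Tendsto (fun k => y - u (φ k + 1) i) atTop (𝓝 (y - a i)) :=
    tendsto_const_nhds.sub (((PiLp.continuous_apply 2 _ i).tendsto a).comp hnext)
  have hinci : Tendsto (fun k => ‖u (φ k + 1) i - u (φ k) i‖) atTop (𝓝 0) := by
    refine squeeze_zero (fun k => norm_nonneg _) (fun k => ?_)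
      (tendsto_zero_iff_norm_tendsto_zero.1 hinc)
    exact PiLp.norm_apply_le (u (φ k + 1) - u (φ k)) i
  have hbound : Tendsto (fun k => |Mu| * (δ (φ k)
      + ‖u (φ k + 1) i - u (φ k) i‖ * ‖y - u (φ k + 1) i‖)) atTop (𝓝 0) := by
    simpa using ((H.err_summable.tendsto_atTop_zero.comp hφ).add
      (hinci.mul hcoord.norm)).const_mul |Mu|
  have hfinal : Tendsto (fun k => |Mu| * (δ (φ k)
      + ‖u (φ k + 1) i - u (φ k) i‖ * ‖y - u (φ k + 1) i‖)
      + inner ℝ (blockGradient f i (mixed i (u (φ k + 1)) (u (φ k)))) (y - u (φ k + 1) i)) atTop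
      (𝓝 (inner ℝ (blockGradient f i a) (y - a i))) := by
    simpa using hbound.add (hgrad.inner hcoord)
  refine ge_of_tendsto' hfinal fun k => ?_
  set g := blockGradient f i (mixed i (u (φ k + 1)) (u (φ k))) with hg
  have hτ := H.tau_pos (φ k) i
  have h1 := H.inner_le (φ k) i y hy
  have h2 : inner ℝ (gradientStep f (τ (φ k) i) i (u (φ k + 1)) (u (φ k)) - u (φ k + 1) i)
      (y - u (φ k + 1) i)
      = -inner ℝ (u (φ k + 1) i - u (φ k) i) (y - u (φ k + 1) i)
        - 1 / τ (φ k) i * inner ℝ g (y - u (φ k + 1) i) := by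
    rw [← inner_neg_left, neg_sub, ← real_inner_smul_left, ← inner_sub_left, gradientStep]
    congr 1
    abel
  have h3 := real_inner_le_norm (u (φ k + 1) i - u (φ k) i) (y - u (φ k + 1) i)
  have h4 : -(1 / τ (φ k) i * inner ℝ g (y - u (φ k + 1) i))
      ≤ δ (φ k) + ‖u (φ k + 1) i - u (φ k) i‖ * ‖y - u (φ k + 1) i‖ := by linarith
  have h5 := mul_le_mul_of_nonneg_left h4 hτ.le
  have h6 : τ (φ k) i * -(1 / τ (φ k) i * inner ℝ g (y - u (φ k + 1) i))
      = -inner ℝ g (y - u (φ k + 1) i) := by field_simp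
  have h7 : τ (φ k) i * (δ (φ k) + ‖u (φ k + 1) i - u (φ k) i‖ * ‖y - u (φ k + 1) i‖)
      ≤ |Mu| * (δ (φ k) + ‖u (φ k + 1) i - u (φ k) i‖ * ‖y - u (φ k + 1) i‖) := by
    have := H.err_nonneg (φ k)
    gcongr
    exact (H.tau_mem (φ k) i).2.trans (le_abs_self _)
  linarith

end IsApproximateRun

/-! ### From the iterates to an approximate run, and the conclusion. -/

/-- The late iterates lie in the enlarged feasible sets, their distance to the feasible sets is of
order `eps k ^ 2`, and they solve the projection inequalities up to an error of that order. -/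
theorem IsIterateSequence.exists_eventual_bounds {n : ℕ} {m p : Fin n → ℕ}
    {f : BlockSpace m → ℝ}
    {h : ∀ i, EuclideanSpace ℝ (Fin (m i)) → EuclideanSpace ℝ (Fin (p i))}
    (hdiff : ∀ i, Differentiable ℝ (h i))
    (hconv : ∀ i j, ConvexOn ℝ univ (fun w => h i w j))
    {epsBar : ℝ} (hScomp : ∀ i, IsCompact (feasibleSet (h i)))
    (hSne : ∀ i, (feasibleSet (h i)).Nonempty)
    (hHoff : ∀ i, HoffmanBoundOn (h i) (Metric.cthickening epsBar (feasibleSet (h i))))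
    {eps : ℕ → ℝ} (heps : Summable (fun k => eps k ^ 2)) {Ml Mu : ℝ}
    {sigma : ℕ → Fin n → ℝ} {z : ℕ → BlockSpace m}
    (hz : IsIterateSequence f h epsBar eps Ml Mu sigma z) :
    ∃ K : ℕ, ∃ C : ℝ, 0 ≤ C ∧ ∀ k ≥ K, ∀ i,
      z (k + 1) i ∈ Metric.cthickening epsBar (feasibleSet (h i)) ∧
      Metric.infDist (z (k + 1) i) (feasibleSet (h i)) ≤ C * eps k ^ 2 ∧
      ∀ y ∈ feasibleSet (h i),
        inner ℝ (gradientStep f (sigma k i) i (z (k + 1)) (z k) - z (k + 1) i)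
          (y - z (k + 1) i) ≤ C * eps k ^ 2 := by
  have hres : ∀ k i, ∃ lam : EuclideanSpace ℝ (Fin (p i)), (∀ j, 0 ≤ lam j) ∧
      residual (h i) (z (k + 1) i) lam (gradientStep f (sigma k i) i (z (k + 1)) (z k))
        ≤ eps k ^ 2 := fun k i =>
    (hz.step k i).imp fun _ hl => ⟨hl.1, (Real.sqrt_le_iff.1 hl.2).2⟩
  have hmem : ∀ᶠ k in atTop, ∀ i,
      z (k + 1) i ∈ Metric.cthickening epsBar (feasibleSet (h i)) := by
    refine eventually_all.2 fun i => ?_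
    obtain ⟨δ, hδ, hlev⟩ := exists_level_infDist_le (hdiff i).continuous (hconv i) (hScomp i)
      (hSne i) hz.epsBar_pos
    filter_upwards [heps.tendsto_atTop_zero.eventually_le_const hδ] with k hk
    obtain ⟨lam, -, hl⟩ := hres k i
    obtain ⟨q, hq, hqd⟩ := (hScomp i).exists_infDist_eq_dist (hSne i) (z (k + 1) i)
    exact Metric.mem_cthickening_of_dist_le _ q _ _ hq
      (hqd ▸ hlev _ fun j => (apply_le_of_residual_le hl j).trans hk)
  obtain ⟨K, hK⟩ := eventually_atTop.1 hmem
  choose c hc0 hc using hHoff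
  choose R hR using fun i => (hScomp i).isBounded.exists_norm_le
  -- The first entry serves the distance estimate, the second the variational inequality, with `R i`
  -- bounding the feasible set.
  obtain ⟨C, hC⟩ := Finite.exists_le fun i => max (c i * √(p i)) (1 + √(m i) * R i)
  have hsq : ∀ k, 0 ≤ eps k ^ 2 := fun k => sq_nonneg _
  refine ⟨K, max C 0, le_max_right _ _, fun k hk i => ⟨hK k hk i, ?_, fun y hy => ?_⟩⟩
  · obtain ⟨lam, -, hl⟩ := hres k i
    calc _ ≤ c i * ‖posPart (h i (z (k + 1) i))‖ := hc i _ (hK k hk i)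
      _ ≤ c i * (√(p i) * eps k ^ 2) := by
        have := hc0 i
        gcongr
        exact (norm_le_mul_normInf _).trans
          (mul_le_mul_of_nonneg_left (normInf_posPart_le_of_residual_le hl) (Real.sqrt_nonneg _))
      _ = (c i * √(p i)) * eps k ^ 2 := by ring
      _ ≤ _ := mul_le_mul_of_nonneg_right
        ((le_max_left _ _).trans ((hC i).trans (le_max_left _ _))) (hsq k)
  · obtain ⟨lam, hlam, hl⟩ := hres k i
    calc _ ≤ eps k ^ 2 * (1 + √(m i) * ‖y‖) :=
          inner_le_of_residual_le (hdiff i) (hconv i) hlam hl hy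
      _ ≤ eps k ^ 2 * (1 + √(m i) * R i) := by gcongr; exact hR i y hy
      _ = (1 + √(m i) * R i) * eps k ^ 2 := by ring
      _ ≤ _ := mul_le_mul_of_nonneg_right
        ((le_max_right _ _).trans ((hC i).trans (le_max_left _ _))) (hsq k)

end PALMI

theorem mainTheorem4 {n : ℕ} {m p : Fin n → ℕ}
    -- the objective and the constraint mappings
    (f : PALMI.BlockSpace m → ℝ) (hf : Differentiable ℝ f)
    (h : ∀ i, EuclideanSpace ℝ (Fin (m i)) → EuclideanSpace ℝ (Fin (p i)))
    (hdiff : ∀ i, Differentiable ℝ (h i))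
    (hconv : ∀ i j, ConvexOn ℝ Set.univ (fun w => h i w j))
    -- the feasible sets and their closed enlargements of radius `epsBar`
    (S : ∀ i, Set (EuclideanSpace ℝ (Fin (m i)))) (hS : ∀ i, S i = PALMI.feasibleSet (h i))
    (epsBar : ℝ)
    (Sbar : ∀ i, Set (EuclideanSpace ℝ (Fin (m i))))
    (hSbar : ∀ i, Sbar i = Metric.cthickening epsBar (S i))
    -- blockwise Lipschitz continuous differentiability, and the parameters built from the moduli
    (Lip : Fin n → ℝ) (hLip : PALMI.BlockLipschitzGradient f Sbar Lip)
    (gam Ml Mu : ℝ) (hgam : 1 < gam) (hMl : Ml = gam * ⨆ i, Lip i)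
    -- convexity, compactness, constraint qualification and Hoffman-like error bound
    (hSconv : ∀ i, Convex ℝ (S i)) (hScomp : ∀ i, IsCompact (S i))
    (hCQ : ∀ i, PALMI.IsLinearConstraint (h i) ∨ PALMI.Slater (h i))
    (hHoff : ∀ i, PALMI.HoffmanBoundOn (h i)
      (Metric.cthickening (PALMI.gradientBound f Sbar i / Ml) (Sbar i)))
    -- the iterates, with square summable tolerances, and the exact subproblem solutions
    (eps : ℕ → ℝ) (heps : Summable (fun k => eps k ^ 2))
    (sigma : ℕ → Fin n → ℝ) (z zbar : ℕ → PALMI.BlockSpace m)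
    (hz : PALMI.IsIterateSequence f h epsBar eps Ml Mu sigma z)
    (hzbar : PALMI.IsExactSequence f S sigma z zbar) :
    ((PALMI.accumulationPoints z).Nonempty ∧
      PALMI.accumulationPoints z ⊆ PALMI.blockProduct S ∧
      ∀ a ∈ PALMI.accumulationPoints z, PALMI.IsStationary (PALMI.extendedObjective f S) a) ∧
    (IsCompact (PALMI.accumulationPoints z) ∧
      IsConnected (PALMI.accumulationPoints z) ∧
      Filter.Tendsto (fun k => Metric.infDist (zbar k) (PALMI.accumulationPoints z))
        Filter.atTop (nhds 0)) ∧
    ∃ c : ℝ, ∀ a ∈ PALMI.accumulationPoints z, PALMI.extendedObjective f S a = (c : EReal) := by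
  obtain rfl : S = fun i => PALMI.feasibleSet (h i) := funext hS
  obtain rfl : Sbar = fun i => Metric.cthickening epsBar (PALMI.feasibleSet (h i)) := funext hSbar
  have hSne : ∀ i, (PALMI.feasibleSet (h i)).Nonempty := fun i => ⟨_, (hzbar 0 i).1⟩
  obtain ⟨K, C, hC, hbounds⟩ := hz.exists_eventual_bounds hdiff hconv hScomp hSne
    (fun i => (hHoff i).imp fun c hc =>
      ⟨hc.1, fun x hx => hc.2 x (Metric.self_subset_cthickening _ hx)⟩) heps
  have hsq : ∀ k, 0 ≤ C * eps k ^ 2 := fun k => mul_nonneg hC (sq_nonneg _)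
  have hsum : ∀ l, Summable fun k => C * eps (k + l) ^ 2 := fun l =>
    ((summable_nat_add_iff l).2 heps).mul_left C
  have hidx : ∀ k, k + K + 1 + 1 = k + 1 + K + 1 := fun k => by omega
  have H : PALMI.IsApproximateRun f (fun i => PALMI.feasibleSet (h i))
      (fun i => Metric.cthickening epsBar (PALMI.feasibleSet (h i))) Lip (⨆ i, Lip i) Ml Mu
      -- The block `z (k + K + 1)` was computed with tolerance `eps (k + K)` and its successor with
      -- `eps (k + (K + 1))`; the error sums both.
      (fun k => sigma (k + K + 1)) (fun k => C * eps (k + K) ^ 2 + C * eps (k + (K + 1)) ^ 2)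
      (fun k => z (k + K + 1)) :=
    { differentiable := hf
      isCompact_S := hScomp
      nonempty_S := hSne
      subset := fun i => Metric.self_subset_cthickening _
      convex_T := fun i => (hSconv i).cthickening _
      isCompact_T := fun i => (hScomp i).cthickening
      lipschitz := hLip
      Lip_le := fun i => le_ciSup (Set.finite_range Lip).bddAbove i
      L_lt := by
        have h0 := hz.Ml_pos
        rw [hMl] at h0 ⊢
        -- `0 < Ml` forces a positive supremum, so `gam > 1` makes the inequality strict.
        have := pos_of_mul_pos_right h0 (by linarith)
        nlinarith
      Ml_pos := hz.Ml_pos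
      tau_mem := fun k i => hz.sigma_mem _ i
      mem := fun k i => (hbounds (k + K) (by omega) i).1
      err_nonneg := fun k => add_nonneg (hsq _) (hsq _)
      err_summable := (hsum K).add (hsum (K + 1))
      infDist_le := fun k i =>
        (hbounds (k + K) (by omega) i).2.1.trans (le_add_of_nonneg_right (hsq _))
      infDist_succ_le := fun k i => by
        rw [← hidx]
        exact (hbounds (k + K + 1) (by omega) i).2.1.trans (le_add_of_nonneg_left (hsq _))
      inner_le := fun k i y hy => by
        rw [← hidx]
        exact ((hbounds (k + K + 1) (by omega) i).2.2 y hy).trans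
          (le_add_of_nonneg_left (hsq _)) }
  obtain ⟨⟨c, hc⟩, hinc⟩ := H.tendsto_values
  have hcompT := PALMI.isCompact_blockProduct H.isCompact_T
  have hevT : ∀ᶠ k in Filter.atTop, z k ∈
      PALMI.blockProduct fun i => Metric.cthickening epsBar (PALMI.feasibleSet (h i)) :=
    (Filter.eventually_atTop).2 ⟨K + 1, fun k hk => by
      obtain ⟨j, rfl⟩ := Nat.exists_eq_add_of_le' hk
      exact H.mem j⟩
  have hincz : Filter.Tendsto (fun k => dist (z (k + 1)) (z k)) Filter.atTop (nhds 0) := by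
    refine (Filter.tendsto_add_atTop_iff_nat (K + 1)).1 ?_
    refine (tendsto_zero_iff_norm_tendsto_zero.1 hinc).congr fun k => ?_
    rw [dist_eq_norm, ← hidx, ← add_assoc]
  have hzzbar : Filter.Tendsto (fun k => dist (zbar k) (z k)) Filter.atTop (nhds 0) := by
    refine (Filter.tendsto_add_atTop_iff_nat (K + 2)).1 ?_
    have := H.tendsto_sub_exact (ubar := fun k => zbar (k + K + 1 + 1))
      (fun k i => (hzbar _ i).1) (fun k i y hy => by
        rw [← hidx]
        exact PALMI.inner_le_zero_of_isMinOn (hz.Ml_pos.trans_le (hz.sigma_mem _ i).1)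
          (hSconv i) (hzbar _ i).1 (hzbar _ i).2 hy)
    refine (tendsto_zero_iff_norm_tendsto_zero.1 this).congr fun k => ?_
    rw [dist_comm, dist_eq_norm, ← hidx]
    rfl
  have hacc : ∀ a ∈ PALMI.accumulationPoints z, ∃ φ : ℕ → ℕ, Filter.Tendsto φ Filter.atTop
      Filter.atTop ∧ Filter.Tendsto ((fun k => z (k + K + 1)) ∘ φ) Filter.atTop (nhds a) := by
    rintro a ⟨φ, hφ, hlim⟩
    -- Since `φ (k + (K + 1)) ≥ k + (K + 1)`, the subtraction does not truncate.
    refine ⟨fun k => φ (k + (K + 1)) - (K + 1), ?_, ?_⟩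
    · exact (Filter.tendsto_sub_atTop_nat _).comp
        (hφ.tendsto_atTop.comp (Filter.tendsto_add_atTop_nat _))
    · refine (hlim.comp (Filter.tendsto_add_atTop_nat (K + 1))).congr fun k => ?_
      have := hφ.id_le (k + (K + 1))
      simp only [Function.comp_apply, id_eq] at this ⊢
      congr 1
      omega
  have hmemS : ∀ a ∈ PALMI.accumulationPoints z,
      a ∈ PALMI.blockProduct fun i => PALMI.feasibleSet (h i) := fun a ha => by
    obtain ⟨φ, hφ, hlim⟩ := hacc a ha
    exact H.mem_of_tendsto hφ hlim
  refine ⟨⟨PALMI.accumulationPoints_nonempty hcompT hevT, hmemS, fun a ha => ?_⟩,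
    ⟨PALMI.isCompact_accumulationPoints hcompT hevT,
      PALMI.isConnected_accumulationPoints hcompT hevT hincz, ?_⟩, c, fun a ha => ?_⟩
  · obtain ⟨φ, hφ, hlim⟩ := hacc a ha
    exact PALMI.isStationary_of_forall_inner_nonneg hf (hmemS a ha)
      fun i y hy => H.inner_nonneg_of_tendsto hφ hlim i hy
  · refine squeeze_zero (fun k => Metric.infDist_nonneg)
      (fun k => Metric.infDist_le_infDist_add_dist (y := z k)) ?_
    simpa using (PALMI.tendsto_infDist_accumulationPoints hcompT hevT).add hzzbar
  · obtain ⟨φ, hφ, hlim⟩ := hacc a ha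
    rw [PALMI.extendedObjective_of_mem (hmemS a ha)]
    exact congrArg _ (tendsto_nhds_unique ((hf.continuous.tendsto a).comp hlim) (hc.comp hφ))
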